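/- Let $\kappa$ be an uncountable regular cardinal, identified with its initial ordinal. A web is a triple $\Lambda=(G,X,Y)$ where $G$ is a digraph and $X,Y\subseteq V(G)$ are such that no edge of $G$ enters $X$ and no edge of $G$ leaves $Y$. All paths below are finite, nonempty, simple and directed (a single vertex is a path); $in(P)$ and $ter(P)$ are the initial and terminal vertices of $P$. For sets $Z,T$ of vertices, a $Z$–$T$ path is a path $P$ with $in(P)\in Z$ and $ter(P)\in T$; a set $S$ of vertices separates $Z$ from $T$ if every $Z$–$T$ path meets $S$. Let $RF(S)$ be the set of vertices $v$ such that $S$ separates $\{v\}$ from $Y$, let $\mathcal E(S)$ be the set of $s\in S$ such that $S\setminus\{s\}$ does not separate $\{s\}$ from $Y$, and let $RF^\circ(S)=RF(S)\setminus\mathcal E(S)$. Suppose that $\Lambda$ is $\kappa$-unbalanced, as witnessed by $f$ and $g$, that is, $f:X\to\kappa$ is a function and $g:Y\to\kappa$ is an injection such that $f[X]$ is stationary in $\kappa$ and $f(in(P))>g(ter(P))$ for every $X$–$Y$ path $P$. Then there is a set $S\subseteq V(G)$ separating $X$ from $Y$ such that: 1. every $s\in S$ is popular in $\Lambda[RF^\circ(S)\cup\{s\}]$,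 that is, either $s\in X$, or there is a set $\mathcal P$ of $X$–$\{s\}$ paths in the subgraph of $G$ induced on $RF^\circ(S)\cup\{s\}$, any two distinct members of which have only the vertex $s$ in common, such that $\{f(in(P)): P\in\mathcal P\}$ is stationary in $\kappa$; 2. $S$ is not strongly popular, that is, there is no set $\mathcal P$ of pairwise vertex-disjoint $X$–$S$ paths, each meeting $X\cup S$ only in its initial and terminal vertices, such that $\{f(in(P)): P\in\mathcal P\}$ is stationary in $\kappa$; 3. $|S\setminus X|\le\kappa$. -/

import Mathlib

open Cardinal Set

universe u

/-- A web `(D, A, B)`: a digraph on the vertex type `V` together with two sets of vertices `A`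
(the source side) and `B` (the target side), such that no edge enters `A` and no edge leaves `B`. -/
structure Web (V : Type u) where
  /-- the underlying digraph -/
  D : Digraph V
  /-- the source side -/
  A : Set V
  /-- the target side -/
  B : Set V
  /-- no edge goes into `A` -/
  no_edge_into_A : ∀ u v, D.Adj u v → v ∉ A
  /-- no edge goes out of `B` -/
  no_edge_out_of_B : ∀ u v, D.Adj u v → u ∉ B

/-- A finite, nonempty, simple directed path in a digraph, given by its list of vertices in order
of traversal. The list `[x]` is the trivial path `(x)`. -/
@[ext]
structure DiPath {V : Type u} (D : Digraph V) where
  /-- the vertices, in order -/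
  verts : List V
  ne_nil : verts ≠ []
  chain : verts.IsChain D.Adj
  nodup : verts.Nodup

namespace DiPath

variable {V : Type u} {D : Digraph V}

/-- The initial vertex `in(P)`. -/
def init (P : DiPath D) : V := P.verts.head P.ne_nil

/-- The terminal vertex `ter(P)`. -/
def ter (P : DiPath D) : V := P.verts.getLast P.ne_nil

/-- The vertex set `V(P)`. -/
def support (P : DiPath D) : Set V := {v | v ∈ P.verts}

/-- `P` is an `S`–`T`-path: it starts in `S` and ends in `T`. -/
def IsPathFromTo (P : DiPath D) (S T : Set V) : Prop := P.init ∈ S ∧ P.ter ∈ T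

/-- A set `F` of paths is `T`-joined if any two distinct paths of `F` meet only in vertices
of `T`. -/
def IsJoined (F : Set (DiPath D)) (T : Set V) : Prop :=
  ∀ P ∈ F, ∀ Q ∈ F, P ≠ Q → P.support ∩ Q.support ⊆ T

/-- A warp of finite paths: a set of pairwise vertex-disjoint paths. -/
def IsWarp (F : Set (DiPath D)) : Prop := IsJoined F ∅

/-- An `S`–`T`-warp: a warp each of whose paths starts in `S`, ends in `T`, and meets `S ∪ T` only
in its initial and terminal vertices. -/
def IsWarpFromTo (F : Set (DiPath D)) (S T : Set V) : Prop :=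
  IsWarp F ∧ ∀ P ∈ F, P.IsPathFromTo S T ∧ P.support ∩ (S ∪ T) = {P.init, P.ter}

end DiPath

namespace Web

variable {V : Type u}

/-- The set `S` separates `Z` from `T`: every `Z`–`T`-path meets `S`. -/
def Separates (Λ : Web V) (S Z T : Set V) : Prop :=
  ∀ P : DiPath Λ.D, P.IsPathFromTo Z T → (P.support ∩ S).Nonempty

/-- `RF(S)`: the set of vertices separated by `S` from the target side. -/
def RF (Λ : Web V) (S : Set V) : Set V := {v | Λ.Separates S {v} Λ.B}

/-- `𝓔(S)`: the set of those `s ∈ S` that are not separated from the target side by `S \ {s}`. -/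
def essential (Λ : Web V) (S : Set V) : Set V := {s ∈ S | ¬ Λ.Separates (S \ {s}) {s} Λ.B}

/-- `RF°(S) = RF(S) \ 𝓔(S)`. -/
def RFo (Λ : Web V) (S : Set V) : Set V := Λ.RF S \ Λ.essential S

variable {κ : Cardinal.{u}}

/-- The functions `f : A → κ` and `g : B → κ` witness that the web is `κ`-unbalanced. Here `κ` is
identified with the set of ordinals below its initial ordinal; only the values of `f` on `A` and
of `g` on `B` are used. -/
structure IsUnbalancedBy (Λ : Web V) (f g : V → Iio κ.ord) : Prop where
  injOn : InjOn g Λ.B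
  stationary : IsStationary (f '' Λ.A)
  regressive : ∀ P : DiPath Λ.D, P.IsPathFromTo Λ.A Λ.B → g P.ter < f P.init

/-- A set `T ⊆ Z` of vertices is popular (with respect to `f`) in the subweb induced on the set
`Z` of vertices: either `T` meets the source side, or there is a `T`-joined family of paths from
the source side to `T`, all of whose vertices are in `Z`, such that the `f`-image of the set of
initial vertices is stationary. -/
def IsPopularWithin (Λ : Web V) (f : V → Iio κ.ord) (Z T : Set V) : Prop :=
  (T ∩ (Λ.A ∩ Z)).Nonempty ∨
    ∃ F : Set (DiPath Λ.D), DiPath.IsJoined F T ∧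
      (∀ P ∈ F, P.IsPathFromTo Λ.A T ∧ P.support ⊆ Z) ∧
      IsStationary (f '' (DiPath.init '' F))

/-- A set `T` of vertices is strongly popular (with respect to `f`): there is a warp from the
source side to `T` such that the `f`-image of the set of initial vertices is stationary. -/
def IsStronglyPopular (Λ : Web V) (f : V → Iio κ.ord) (T : Set V) : Prop :=
  ∃ F : Set (DiPath Λ.D), DiPath.IsWarpFromTo F Λ.A T ∧ IsStationary (f '' (DiPath.init '' F))

end Web

/-! ### Clubs, diagonal intersections and pressing down. -/

section Stationary

open Order

/-! The set `S` consists of the essential vertices of `T`, the set of all vertices popular in the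
whole web. It separates because the last vertex in `T` of an `A`–`B` path is essential
(`separates_essential`).

The other three properties come from Fodor's lemma, used as
`IsStationary.exists_const_of_mem_finite`: if stationarily many objects each pick a vertex from a
finite set attached to a smaller index, stationarily many pick the same one.

If `S` were strongly popular, extend a witnessing warp to `B` by paths avoiding `T` after `S`. Since
`g` is injective and regressive along paths, stationarily many extensions end at one vertex. Cutting
each where it first meets an earlier one yields a popular vertex common to stationarily many; it
must lie on the warp paths, which are disjoint.

For `s ∈ S \ A`, cut the paths witnessing its popularity at their first vertex in `S`. If
stationarily many stopped before `s` they would form a warp to `S`; so stationarily many reach `s`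
from behind `S`.

For the cardinality, a greedy warp with at most one path per index below `κ` must end at every
vertex of `S \ A`. -/

theorem isClub_Ioi {α : Type*} [LinearOrder α] [NoMaxOrder α] (a : α) : IsClub (Ioi a) where
  dirSupClosed := fun _ hd ⟨x, hx⟩ _ _ hb ↦ (hd hx).trans_le (hb.1 hx)
  isCofinal := fun b ↦ by
    obtain ⟨c, hc⟩ := exists_gt (max a b)
    exact ⟨c, (le_max_left _ _).trans_lt hc, (le_max_right _ _).trans hc.le⟩

theorem noMaxOrder_of_aleph0_lt_cof {α : Type*} [LinearOrder α] (hα : ℵ₀ < cof α) : NoMaxOrder α := by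
  cases topOrderOrNoTopOrder α with
  | inl h => exact absurd (hα.trans_eq (cof_eq_one (α := α))) (not_lt.2 one_lt_aleph0.le)
  | inr h => exact (noTopOrder_iff_noMaxOrder α).1 h

variable {α : Type*} [LinearOrder α] [WellFoundedLT α]

theorem IsStationary.inter_isClub (hα : ℵ₀ < cof α) {s t : Set α} (hs : IsStationary s)
    (ht : IsClub t) : IsStationary (s ∩ t) := fun u hu ↦ by
  rw [inter_assoc]
  exact hs (ht.inter hα.ne' hu)

theorem IsStationary.inter_Ioi (hα : ℵ₀ < cof α) {s : Set α} (hs : IsStationary s) (a : α) :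
    IsStationary (s ∩ Ioi a) :=
  have := noMaxOrder_of_aleph0_lt_cof hα
  hs.inter_isClub hα (isClub_Ioi a)

theorem IsStationary.exists_gt_mem (hα : ℵ₀ < cof α) {s : Set α} (hs : IsStationary s) (a : α) :
    ∃ b ∈ s, a < b :=
  (hs.inter_Ioi hα a).nonempty

/-- The diagonal intersection of club sets is a club set. -/
theorem IsClub.diagonal (hα : ℵ₀ < cof α) (hI : ∀ a : α, #(Iio a) < cof α) {C : α → Set α}
    (hC : ∀ a, IsClub (C a)) : IsClub {x | ∀ a < x, x ∈ C a} where
  dirSupClosed := by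
    rintro d hd - - x hx a hax
    obtain ⟨y, hy, hay⟩ := (lt_isLUB_iff hx).1 hax
    refine (hC a).isLUB_mem (t := d ∩ Ioi a) (fun z hz ↦ hd hz.1 a hz.2) ⟨y, hy, hay⟩
      ⟨fun z hz ↦ hx.1 hz.1, fun b hb ↦ hx.2 fun z hz ↦ ?_⟩
    obtain h | h := lt_or_ge a z
    · exact hb ⟨hz, h⟩
    · exact h.trans (hay.le.trans (hb ⟨hy, hay⟩))
  isCofinal := by
    intro x
    have := noMaxOrder_of_aleph0_lt_cof hα
    have step : ∀ y, ∃ z, y < z ∧ ∀ a < y, z ∈ C a := fun y ↦ by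
      have hc : IsClub (⋂ a : Iio y, C a) := by
        refine IsClub.iInter hα.ne' ?_ fun a ↦ hC a
        simpa using hI y
      have : Nonempty α := ⟨x⟩
      obtain ⟨z, hz⟩ := (hc.inter hα.ne' (isClub_Ioi y)).nonempty
      exact ⟨z, hz.2, fun a ha ↦ mem_iInter.1 hz.1 ⟨a, ha⟩⟩
    choose n hn hnC using step
    -- The supremum of this sequence is in the diagonal intersection: any `a` below it is below some
    -- `s k`, and all later terms are in `C a`.
    let s : ℕ → α := fun k ↦ n^[k] x
    have hs (k) : s (k + 1) = n (s k) := Function.iterate_succ_apply' n k x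
    have hmono : StrictMono s := strictMono_nat_of_lt_succ fun k ↦ hs k ▸ hn _
    have hb : BddAbove (range s) := by
      refine .of_not_isCofinal fun h ↦ (cof_le h).not_gt (hα.trans_le' ?_)
      simpa using mk_range_le_lift (f := s)
    obtain ⟨b, hbl⟩ : ∃ b, IsLUB (range s) b := by
      obtain ⟨b, hb, hmin⟩ := wellFounded_lt.has_min _ hb
      exact ⟨b, hb, fun c hc ↦ not_lt.1 (hmin c hc)⟩
    refine ⟨b, fun a hab ↦ ?_, hbl.1 ⟨0, rfl⟩⟩
    obtain ⟨_, ⟨k, rfl⟩, hk⟩ := (lt_isLUB_iff hbl).1 hab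
    have hmem (j) (hj : k < j) : s j ∈ C a := by
      obtain ⟨j, rfl⟩ : ∃ i, j = i + 1 := ⟨j - 1, by omega⟩
      rw [hs]
      exact hnC _ _ (hk.trans_le (hmono.monotone (by omega)))
    refine (hC a).isLUB_mem (t := s '' Ioi k) ?_ ⟨_, k + 1, by simp, rfl⟩ ⟨?_, fun c hc ↦ hbl.2 ?_⟩
    · rintro _ ⟨j, hj, rfl⟩
      exact hmem j hj
    · rintro _ ⟨j, -, rfl⟩
      exact hbl.1 ⟨j, rfl⟩
    · rintro _ ⟨j, rfl⟩
      exact (hmono.monotone (show j ≤ k + j + 1 by omega)).trans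
        (hc ⟨k + j + 1, show k < k + j + 1 by omega, rfl⟩)

/-- Fodor's pressing down lemma. -/
theorem IsStationary.exists_const_of_regressive (hα : ℵ₀ < cof α) (hI : ∀ a : α, #(Iio a) < cof α)
    {s : Set α} (hs : IsStationary s) {r : α → α} (hr : ∀ a ∈ s, r a < a) :
    ∃ b, IsStationary {a ∈ s | r a = b} := by
  by_contra! h
  simp_rw [not_isStationary_iff] at h
  choose C hC hd using h
  obtain ⟨a, has, haC⟩ := hs (IsClub.diagonal hα hI hC)
  exact (hd (r a)).le_bot ⟨⟨has, rfl⟩, haC _ (hr a has)⟩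

/-- A map choosing, at every point of a stationary set, a member of one of the finite sets indexed
by smaller points is constant on a stationary set. -/
theorem IsStationary.exists_const_of_mem_finite (hα : ℵ₀ < cof α)
    (hI : ∀ a : α, #(Iio a) < cof α) {β : Type*} {s : Set α} (hs : IsStationary s) {W : α → Set β}
    (hW : ∀ a, (W a).Finite) {v : α → β} (hv : ∀ a ∈ s, ∃ b < a, v a ∈ W b) :
    ∃ x, IsStationary {a ∈ s | v a = x} := by
  choose! r hr hvr using hv
  obtain ⟨b, hb⟩ := hs.exists_const_of_regressive hα hI hr
  have : {a ∈ s | r a = b} ⊆ ⋃ x : W b, {a ∈ s | v a = x} := fun a ha ↦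
    mem_iUnion.2 ⟨⟨v a, ha.2 ▸ hvr a ha.1⟩, ha.1, rfl⟩
  have := (hW b).to_subtype
  obtain ⟨x, hx⟩ := (isStationary_iUnion_iff_of_countable hα.ne').1 (hb.mono ‹_›)
  exact ⟨x, hx⟩

end Stationary

theorem cof_Iio_ord_of_isRegular {κ : Cardinal.{u}} (hκ : κ.IsRegular) :
    Order.cof (Iio κ.ord) = Cardinal.lift.{u + 1} κ := by
  rw [Ordinal.cof_Iio, ← Ordinal.lift_cof, hκ.cof_ord]

theorem mk_Iio_lt_cof_of_isRegular {κ : Cardinal.{u}} (hκ : κ.IsRegular) (a : Iio κ.ord) :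
    #(Iio a) < Order.cof (Iio κ.ord) := by
  rw [cof_Iio_ord_of_isRegular hκ]
  have h : #(Iio a) ≤ #(Iio a.1) := mk_le_of_injective (f := fun b ↦ ⟨b.1.1, b.2⟩) fun b c h ↦ by
    simpa [Subtype.ext_iff] using h
  refine h.trans_lt ?_
  rw [Cardinal.mk_Iio_ordinal, Cardinal.lift_lt]
  exact lt_ord.1 a.2

theorem List.exists_append_cons_first {β : Type*} {p : β → Prop} {l : List β}
    (h : ∃ x ∈ l, p x) : ∃ l₁ x l₂, l = l₁ ++ x :: l₂ ∧ p x ∧ ∀ z ∈ l₁, ¬ p z := by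
  induction l with
  | nil => simp at h
  | cons a l ih =>
    by_cases ha : p a
    · exact ⟨[], a, l, by simp, ha, by simp⟩
    · obtain ⟨l₁, x, l₂, rfl, hx, hl⟩ := ih (by simpa [ha] using h)
      exact ⟨a :: l₁, x, l₂, rfl, hx, by simpa [ha] using hl⟩

theorem List.exists_append_cons_last {β : Type*} {p : β → Prop} {l : List β}
    (h : ∃ x ∈ l, p x) : ∃ l₁ x l₂, l = l₁ ++ x :: l₂ ∧ p x ∧ ∀ z ∈ l₂, ¬ p z := by
  obtain ⟨l₁, x, l₂, h₁, hx, hl⟩ := List.exists_append_cons_first (l := l.reverse) (by simpa using h)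
  exact ⟨l₂.reverse, x, l₁.reverse, by simpa using congrArg List.reverse h₁, hx, by simpa using hl⟩

/-! ### Cutting and joining finite paths. -/

namespace DiPath

variable {V : Type u} {D : Digraph V}

theorem init_mem_support (P : DiPath D) : P.init ∈ P.support := List.head_mem _

theorem ter_mem_support (P : DiPath D) : P.ter ∈ P.support := List.getLast_mem _

theorem finite_support (P : DiPath D) : P.support.Finite := P.verts.finite_toSet

/-- Cut at the first vertex in `T`. The last clause says that a proper prefix misses the end of `P`.
-/
theorem exists_prefix (P : DiPath D) {T : Set V} (h : (P.support ∩ T).Nonempty) :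
    ∃ Q : DiPath D, Q.init = P.init ∧ Q.ter ∈ T ∧ Q.support ⊆ P.support ∧
      (∀ v ∈ Q.support, v ∈ T → v = Q.ter) ∧ (P.ter ∈ Q.support → Q.ter = P.ter) := by
  obtain ⟨l₁, x, l₂, hP, hx, hl⟩ := List.exists_append_cons_first (p := (· ∈ T)) h
  have hc := P.chain
  have hn := P.nodup
  have hP' : P.verts = (l₁ ++ [x]) ++ l₂ := by simp [hP]
  rw [hP'] at hc hn
  refine ⟨⟨l₁ ++ [x], by simp, hc.left_of_append, hn.of_append_left⟩, ?_, ?_, ?_, ?_, ?_⟩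
  · simp only [init, hP']
    cases l₁ <;> simp
  · simpa [ter] using hx
  · intro v hv
    simp only [support, mem_ofPred_eq, hP'] at hv ⊢
    exact List.mem_append_left _ hv
  · intro v hv hvT
    obtain hv | hv := List.mem_append.1 hv
    · exact absurd hvT (hl v hv)
    · simpa [ter] using hv
  · intro h
    have e : P.ter = (x :: l₂).getLast (by simp) := by simp [ter, hP]
    have e' : P.ter ∈ x :: l₂ := e ▸ List.getLast_mem _
    rw [List.append_assoc] at hn
    obtain h | h := List.mem_append.1 h
    · exact ((List.disjoint_of_nodup_append hn) h e').elim
    · simpa [ter, eq_comm] using h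

theorem exists_suffix (P : DiPath D) {T : Set V} (h : (P.support ∩ T).Nonempty) :
    ∃ Q : DiPath D, Q.ter = P.ter ∧ Q.init ∈ T ∧ Q.support ⊆ P.support ∧
      ∀ v ∈ Q.support, v ∈ T → v = Q.init := by
  obtain ⟨l₁, x, l₂, hP, hx, hl⟩ := List.exists_append_cons_last (p := (· ∈ T)) h
  have hc := P.chain
  have hn := P.nodup
  rw [hP] at hc hn
  refine ⟨⟨x :: l₂, by simp, hc.right_of_append, hn.of_append_right⟩, ?_, hx, ?_, ?_⟩
  · simp [ter, hP]
  · intro v hv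
    simp only [support, mem_ofPred_eq, hP] at hv ⊢
    exact List.mem_append_right _ hv
  · intro v hv hvT
    obtain rfl | hv := List.mem_cons.1 hv
    · rfl
    · exact absurd hvT (hl v hv)

/-- Leaving `P` at its first vertex on `Q` keeps the result simple. -/
theorem exists_concat (P Q : DiPath D) (h : P.ter = Q.init) :
    ∃ R : DiPath D, R.init = P.init ∧ R.ter = Q.ter ∧ R.support ⊆ P.support ∪ Q.support := by
  obtain ⟨P', hi, hP'Q, hP'P, hP', -⟩ := P.exists_prefix (T := Q.support)
    ⟨P.ter, P.ter_mem_support, h ▸ Q.init_mem_support⟩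
  obtain ⟨Q', ht, hQ'i, hQ'Q, -⟩ := Q.exists_suffix (T := {P'.ter}) ⟨P'.ter, hP'Q, rfl⟩
  have hQ'i : Q'.init = P'.ter := hQ'i
  obtain ⟨l, hl⟩ : ∃ l, P'.verts = l ++ [P'.ter] :=
    ⟨_, (List.dropLast_append_getLast P'.ne_nil).symm⟩
  obtain ⟨m, hm⟩ : ∃ m, Q'.verts = P'.ter :: m :=
    ⟨Q'.verts.tail, by rw [← hQ'i]; exact (List.cons_head_tail Q'.ne_nil).symm⟩
  have hPc := P'.chain
  have hPn := P'.nodup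
  have hQc := Q'.chain
  have hQn := Q'.nodup
  rw [hl] at hPc hPn
  rw [hm] at hQc hQn
  refine ⟨⟨l ++ P'.ter :: m, by simp, ?_, ?_⟩, ?_, ?_, ?_⟩
  · rw [List.isChain_append] at hPc ⊢
    refine ⟨hPc.1, hQc, ?_⟩
    simpa using hPc.2.2
  · rw [List.nodup_append'] at hPn ⊢
    refine ⟨hPn.1, hQn, fun v hv hvQ ↦ ?_⟩
    have : v = P'.ter := hP' v (show v ∈ P'.verts by simp [hl, hv])
      (hQ'Q (show v ∈ Q'.verts by rwa [hm]))
    exact hPn.2.2 hv (by simp [this])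
  · rw [← hi]
    simp only [init, hl]
    cases l <;> simp
  · rw [← ht]
    simp [ter, hm]
  · intro v hv
    obtain hv | hv := List.mem_append.1 hv
    · exact Or.inl (hP'P (show v ∈ P'.verts by simp [hl, hv]))
    · exact Or.inr (hQ'Q (show v ∈ Q'.verts by rwa [hm]))

theorem eq_init_of_forall_not_adj (P : DiPath D) {v : V} (hv : v ∈ P.support)
    (h : ∀ u, ¬ D.Adj u v) : v = P.init := by
  obtain ⟨l₁, l₂, hl⟩ := List.append_of_mem hv
  have hc := P.chain
  rw [hl, List.isChain_append] at hc
  obtain rfl | ⟨l, u, rfl⟩ := l₁.eq_nil_or_concat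
  · simp [init, hl]
  · exact absurd (hc.2.2 u (by simp) v (by simp)) (h u)

variable {κ : Type*} [LinearOrder κ] [WellFoundedLT κ]

/-- If the paths of a family indexed by a stationary set share a vertex, then stationarily many of
them have initial segments which end in a common vertex and are otherwise disjoint. -/
theorem exists_prefixes_disjoint (hκ : ℵ₀ < Order.cof κ) (hI : ∀ a : κ, #(Iio a) < Order.cof κ)
    {A : Set κ} (hA : IsStationary A) {W : κ → DiPath D} {y : V}
    (hy : ∀ a ∈ A, y ∈ (W a).support) :
    ∃ r, ∃ A' ⊆ A, IsStationary A' ∧ ∃ Q : κ → DiPath D,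
      (∀ a ∈ A', (Q a).init = (W a).init ∧ (Q a).ter = r ∧ (Q a).support ⊆ (W a).support) ∧
      ∀ a ∈ A', ∀ b ∈ A', a ≠ b → (Q a).support ∩ (Q b).support ⊆ {r} := by
  obtain ⟨a₀, ha₀⟩ := hA.nonempty
  have hA₁ := hA.inter_Ioi hκ a₀
  have key : ∀ a ∈ A ∩ Ioi a₀, ∃ Q : DiPath D, Q.init = (W a).init ∧
      Q.support ⊆ (W a).support ∧ (∃ b < a, Q.ter ∈ {v ∈ (W b).support | b ∈ A}) ∧
      ∀ v ∈ Q.support, (∃ b ∈ A, b < a ∧ v ∈ (W b).support) → v = Q.ter := fun a ha ↦ by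
    -- Cut `W a` where it first meets an earlier path; `y` on `W a₀` ensures that it does.
    obtain ⟨Q, hi, ⟨b, hb, hba, hbW⟩, hs, hQ, -⟩ := (W a).exists_prefix
      (T := {v | ∃ b ∈ A, b < a ∧ v ∈ (W b).support})
      ⟨y, hy a ha.1, a₀, ha₀, ha.2, hy a₀ ha₀⟩
    exact ⟨Q, hi, hs, ⟨b, hba, hbW, hb⟩, hQ⟩
  have : Nonempty (DiPath D) := ⟨W a₀⟩
  choose! Q hQi hQs hQb hQ using key
  obtain ⟨r, hr⟩ := hA₁.exists_const_of_mem_finite hκ hI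
    (W := fun b ↦ {v ∈ (W b).support | b ∈ A}) (fun b ↦ (W b).finite_support.subset fun v hv ↦ hv.1)
    (v := fun a ↦ (Q a).ter) hQb
  refine ⟨r, _, fun a ha ↦ ha.1.1, hr, Q, fun a ha ↦ ⟨hQi a ha.1, ha.2, hQs a ha.1⟩, ?_⟩
  have aux : ∀ a ∈ A ∩ Ioi a₀, ∀ b ∈ {b ∈ A ∩ Ioi a₀ | (Q b).ter = r}, a < b →
      (Q a).support ∩ (Q b).support ⊆ {r} := fun a ha b hb hab v hv ↦
    (hQ b hb.1 v hv.2 ⟨a, ha.1, hab, hQs a ha hv.1⟩).trans hb.2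
  intro a ha b hb hab
  obtain h | h := hab.lt_or_gt
  · exact aux a ha.1 b hb h
  · rw [inter_comm]
    exact aux b hb.1 a ha h

end DiPath

/-- Greedy choice along a well-order: at every stage an admissible element related to all earlier
choices is chosen whenever there is one. -/
theorem exists_greedy_choice {α β : Type*} [LinearOrder α] [WellFoundedLT α] (p : α → β → Prop)
    (r : β → β → Prop) : ∃ G : α → Option β,
      (∀ a x, G a = some x → p a x ∧ ∀ b < a, ∀ y, G b = some y → r y x) ∧
      ∀ a, G a = none → ∀ x, p a x → ∃ b < a, ∃ y, G b = some y ∧ ¬ r y x := by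
  classical
  let F : ∀ a : α, (∀ b, b < a → Option β) → Option β := fun a prev ↦
    if h : ∃ x, p a x ∧ ∀ b, ∀ hb : b < a, ∀ y, prev b hb = some y → r y x then some h.choose
    else none
  let G : α → Option β := wellFounded_lt.fix F
  have hG (a : α) : G a = F a fun b _ ↦ G b := wellFounded_lt.fix_eq F a
  refine ⟨G, fun a x hx ↦ ?_, fun a ha x hx ↦ ?_⟩
  · rw [hG] at hx
    simp only [F] at hx
    split_ifs at hx with h
    obtain rfl := Option.some.inj hx
    exact h.choose_spec
  · by_contra! hcon
    rw [hG] at ha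
    simp only [F] at ha
    split_ifs at ha with h
    exact h ⟨x, hx, hcon⟩

/-! ### Popular vertices and the separating set. -/

namespace Web

variable {V : Type u} {κ : Cardinal.{u}} {Λ : Web V} {f g : V → Iio κ.ord} {S : Set V}

theorem eq_init_of_mem_A (Λ : Web V) (P : DiPath Λ.D) {v : V} (hv : v ∈ P.support)
    (hA : v ∈ Λ.A) : v = P.init :=
  P.eq_init_of_forall_not_adj hv fun u h ↦ Λ.no_edge_into_A u v h hA

/-- The set of vertices which are popular in the whole web. -/
def popular (Λ : Web V) (f : V → Iio κ.ord) : Set V := {v | Λ.IsPopularWithin f univ {v}}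

theorem A_subset_popular : Λ.A ⊆ Λ.popular f := fun v hv ↦ Or.inl ⟨v, rfl, hv, mem_univ v⟩

theorem exists_indexing {F : Set (DiPath Λ.D)} (hF : IsStationary (f '' (DiPath.init '' F))) :
    ∃ P : Iio κ.ord → DiPath Λ.D,
      ∀ a ∈ f '' (DiPath.init '' F), P a ∈ F ∧ f (P a).init = a := by
  obtain ⟨_, _, ⟨P₀, _, _⟩, _⟩ := hF.nonempty
  have : Nonempty (DiPath Λ.D) := ⟨P₀⟩
  have h : ∀ a ∈ f '' (DiPath.init '' F), ∃ P : DiPath Λ.D, P ∈ F ∧ f P.init = a := by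
    rintro _ ⟨_, ⟨P, hP, rfl⟩, rfl⟩
    exact ⟨P, hP, rfl⟩
  choose! P hP using h
  exact ⟨P, hP⟩

theorem isStationary_image_init {A : Set (Iio κ.ord)} (hA : IsStationary A)
    {P : Iio κ.ord → DiPath Λ.D} (hf : ∀ a ∈ A, f (P a).init = a) :
    IsStationary (f '' (DiPath.init '' (P '' A))) :=
  hA.mono fun a ha ↦ ⟨_, ⟨_, ⟨a, ha, rfl⟩, rfl⟩, hf a ha⟩

theorem isStronglyPopular_of_indexing {A : Set (Iio κ.ord)} (hA : IsStationary A)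
    {P : Iio κ.ord → DiPath Λ.D}
    (hP : ∀ a ∈ A, (P a).init ∈ Λ.A ∧ f (P a).init = a ∧ (P a).ter ∈ S ∧
      ∀ v ∈ (P a).support, v ∈ S → v = (P a).ter)
    (hd : ∀ a ∈ A, ∀ b ∈ A, a < b → Disjoint (P a).support (P b).support) :
    Λ.IsStronglyPopular f S := by
  refine ⟨P '' A, ⟨?_, ?_⟩, isStationary_image_init hA fun a ha ↦ (hP a ha).2.1⟩
  · rintro _ ⟨a, ha, rfl⟩ _ ⟨b, hb, rfl⟩ hab
    have hab : a ≠ b := fun h ↦ hab (h ▸ rfl)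
    obtain h | h := hab.lt_or_gt
    · exact (hd a ha b hb h).le_bot
    · exact (hd b hb a ha h).symm.le_bot
  · rintro _ ⟨a, ha, rfl⟩
    obtain ⟨hi, -, ht, h⟩ := hP a ha
    refine ⟨⟨hi, ht⟩, Subset.antisymm ?_ ?_⟩
    · rintro v ⟨hv, hvA | hvS⟩
      · exact Or.inl (Λ.eq_init_of_mem_A _ hv hvA)
      · exact Or.inr (h v hv hvS)
    · rintro v (rfl | rfl)
      · exact ⟨(P a).init_mem_support, Or.inl hi⟩
      · exact ⟨(P a).ter_mem_support, Or.inr ht⟩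

/-- If paths starting at stationarily many places share a vertex, then stationarily many of them
share a popular vertex. -/
theorem exists_mem_popular (hc : ℵ₀ < Order.cof (Iio κ.ord))
    (hI : ∀ a : Iio κ.ord, #(Iio a) < Order.cof (Iio κ.ord)) {A : Set (Iio κ.ord)}
    (hA : IsStationary A) {W : Iio κ.ord → DiPath Λ.D}
    (hW : ∀ a ∈ A, (W a).init ∈ Λ.A ∧ f (W a).init = a) {y : V}
    (hy : ∀ a ∈ A, y ∈ (W a).support) :
    ∃ r ∈ Λ.popular f, ∃ A' ⊆ A, IsStationary A' ∧ ∀ a ∈ A', r ∈ (W a).support := by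
  obtain ⟨r, A', hA'A, hA', Q, hQ, hd⟩ := DiPath.exists_prefixes_disjoint hc hI hA hy
  refine ⟨r, Or.inr ⟨Q '' A', ?_, ?_, ?_⟩, A', hA'A, hA', fun a ha ↦ ?_⟩
  · rintro _ ⟨a, ha, rfl⟩ _ ⟨b, hb, rfl⟩ hab
    exact hd a ha b hb fun h ↦ hab (h ▸ rfl)
  · rintro _ ⟨a, ha, rfl⟩
    obtain ⟨hi, ht, -⟩ := hQ a ha
    exact ⟨⟨hi ▸ (hW a (hA'A ha)).1, ht⟩, subset_univ _⟩
  · exact isStationary_image_init hA' fun a ha ↦ (hQ a ha).1 ▸ (hW a (hA'A ha)).2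
  · obtain ⟨-, ht, hs⟩ := hQ a ha
    exact hs (ht ▸ (Q a).ter_mem_support)

theorem separates_essential {T : Set V} (hT : Λ.A ⊆ T) : Λ.Separates (Λ.essential T) Λ.A Λ.B := by
  intro P hP
  obtain ⟨Q, ht, hi, hs, hQ⟩ := P.exists_suffix (T := T) ⟨_, P.init_mem_support, hT hP.1⟩
  refine ⟨Q.init, hs Q.init_mem_support, hi, fun h ↦ ?_⟩
  obtain ⟨v, hv, hvT, hne⟩ := h Q ⟨rfl, ht ▸ hP.2⟩
  exact hne (hQ v hv hvT)

theorem not_isStronglyPopular_essential_popular (hc : ℵ₀ < Order.cof (Iio κ.ord))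
    (hI : ∀ a : Iio κ.ord, #(Iio a) < Order.cof (Iio κ.ord)) (hfg : Λ.IsUnbalancedBy f g) :
    ¬ Λ.IsStronglyPopular f (Λ.essential (Λ.popular f)) := by
  rintro ⟨F, ⟨hwarp, hF⟩, hst⟩
  obtain ⟨P, hP⟩ := exists_indexing hst
  set A := f '' (DiPath.init '' F)
  have key : ∀ a ∈ A, ∃ Q W : DiPath Λ.D, Q.ter ∈ Λ.B ∧
      (∀ v ∈ Q.support, v ∈ Λ.popular f → v = (P a).ter) ∧ W.init = (P a).init ∧
      W.ter = Q.ter ∧ W.support ⊆ (P a).support ∪ Q.support := fun a ha ↦ by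
    have he := (hF _ (hP a ha).1).1.2.2
    simp only [Separates, not_forall] at he
    obtain ⟨Q, ⟨hQi, hQt⟩, hQ⟩ := he
    obtain ⟨W, hW⟩ := (P a).exists_concat Q (Eq.symm hQi)
    refine ⟨Q, W, hQt, fun v hv hp ↦ ?_, hW⟩
    by_contra hne
    exact hQ ⟨v, hv, hp, hne⟩
  have : Nonempty (DiPath Λ.D) := ⟨P hst.nonempty.some⟩
  choose! Q W hQB hQ hWi hWt hW using key
  have hWA : ∀ a ∈ A, (W a).init ∈ Λ.A ∧ f (W a).init = a := fun a ha ↦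
    ⟨hWi a ha ▸ (hF _ (hP a ha).1).1.1, hWi a ha ▸ (hP a ha).2⟩
  obtain ⟨y, hy⟩ := hst.exists_const_of_mem_finite hc hI (W := fun b ↦ {y ∈ Λ.B | g y = b})
    (fun b ↦ Set.Subsingleton.finite fun x hx y hy ↦ hfg.injOn hx.1 hy.1 (hx.2.trans hy.2.symm))
    (v := fun a ↦ (W a).ter) fun a ha ↦ by
      have hB : (W a).ter ∈ Λ.B := hWt a ha ▸ hQB a ha
      have := hfg.regressive (W a) ⟨(hWA a ha).1, hB⟩
      rw [(hWA a ha).2] at this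
      exact ⟨_, this, hB, rfl⟩
  obtain ⟨r, hr, A', hA'A, hA', hrW⟩ := exists_mem_popular hc hI hy
    (fun a ha ↦ hWA a ha.1) fun a ha ↦ ha.2 ▸ (W a).ter_mem_support
  -- The extension `Q a` meets the popular set only at the end of `P a`.
  have hrP : ∀ a ∈ A', r ∈ (P a).support := fun a ha ↦ by
    obtain h | h := hW a (hA'A ha).1 (hrW a ha)
    · exact h
    · exact hQ a (hA'A ha).1 r h hr ▸ (P a).ter_mem_support
  obtain ⟨a, ha⟩ := hA'.nonempty
  obtain ⟨b, hb, hab⟩ := hA'.exists_gt_mem hc a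
  refine hwarp _ (hP a (hA'A ha).1).1 _ (hP b (hA'A hb).1).1 (fun h ↦ hab.ne ?_)
    ⟨hrP a ha, hrP b hb⟩
  rw [← (hP a (hA'A ha).1).2, h, (hP b (hA'A hb).1).2]

/-- A stationary family of paths to `s`, disjoint except at `s`, which stay on the source side of
`S` and meet `S` only in `s`. -/
def IsPopularBehind (Λ : Web V) (f : V → Iio κ.ord) (S : Set V) (s : V) : Prop :=
  ∃ A : Set (Iio κ.ord), IsStationary A ∧ ∃ P : Iio κ.ord → DiPath Λ.D,
    (∀ a ∈ A, (P a).init ∈ Λ.A ∧ f (P a).init = a ∧ (P a).ter = s ∧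
      (P a).support ⊆ Λ.RFo S ∪ {s} ∧ ∀ v ∈ (P a).support, v ∈ S → v = s) ∧
    ∀ a ∈ A, ∀ b ∈ A, a ≠ b → (P a).support ∩ (P b).support ⊆ {s}

theorem IsPopularBehind.isPopularWithin {s : V} (h : Λ.IsPopularBehind f S s) :
    Λ.IsPopularWithin f (Λ.RFo S ∪ {s}) {s} := by
  obtain ⟨A, hA, P, hP, hd⟩ := h
  refine Or.inr ⟨P '' A, ?_, ?_, isStationary_image_init hA fun a ha ↦ (hP a ha).2.1⟩
  · rintro _ ⟨a, ha, rfl⟩ _ ⟨b, hb, rfl⟩ hab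
    exact hd a ha b hb fun h ↦ hab (h ▸ rfl)
  · rintro _ ⟨a, ha, rfl⟩
    obtain ⟨hi, -, ht, hs, -⟩ := hP a ha
    exact ⟨⟨hi, ht⟩, hs⟩

/-- Prefixing a path to `B` from a non-final vertex of `Q` with the segment of `Q` up to it gives an
`A`–`B` path; it meets `S`, but not on that segment. -/
theorem support_subset_RFo (hS : Λ.Separates S Λ.A Λ.B) {Q : DiPath Λ.D} (hi : Q.init ∈ Λ.A)
    (hQ : ∀ v ∈ Q.support, v ∈ S → v = Q.ter) : Q.support ⊆ Λ.RFo S ∪ {Q.ter} := by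
  intro v hv
  by_cases hvt : v = Q.ter
  · exact Or.inr hvt
  refine Or.inl ⟨fun R hR ↦ ?_, fun h ↦ hvt (hQ v hv h.1)⟩
  obtain ⟨Q', hi', ht', hs', -, hter⟩ := Q.exists_prefix (T := {v}) ⟨v, hv, rfl⟩
  obtain ⟨W, hWi, hWt, hW⟩ := Q'.exists_concat R ((show Q'.ter = v from ht').trans (Eq.symm hR.1))
  obtain ⟨z, hz, hzS⟩ := hS W ⟨by rwa [hWi, hi'], hWt ▸ hR.2⟩
  obtain h | h := hW hz
  · have e := hQ z (hs' h) hzS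
    exact absurd ((hter (e ▸ h)).symm.trans ht').symm hvt
  · exact ⟨z, h, hzS⟩

theorem isPopularBehind_of_mem_popular (hc : ℵ₀ < Order.cof (Iio κ.ord))
    (hS : Λ.Separates S Λ.A Λ.B) (hns : ¬ Λ.IsStronglyPopular f S) {s : V} (hs : s ∈ S)
    (hsp : s ∈ Λ.popular f) (hsA : s ∉ Λ.A) : Λ.IsPopularBehind f S s := by
  obtain ⟨_, rfl, h, -⟩ | ⟨F, hj, hF, hst⟩ := hsp
  · exact absurd h hsA
  obtain ⟨P, hP⟩ := exists_indexing hst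
  set A := f '' (DiPath.init '' F)
  have : Nonempty (DiPath Λ.D) := ⟨P hst.nonempty.some⟩
  have key : ∀ a ∈ A, ∃ Q : DiPath Λ.D, Q.init = (P a).init ∧ Q.ter ∈ S ∧
      Q.support ⊆ (P a).support ∧ ∀ v ∈ Q.support, v ∈ S → v = Q.ter := fun a ha ↦ by
    have ht : (P a).ter = s := (hF _ (hP a ha).1).1.2
    obtain ⟨Q, h₁, h₂, h₃, h₄, -⟩ := (P a).exists_prefix (T := S)
      ⟨_, (P a).ter_mem_support, ht ▸ hs⟩
    exact ⟨Q, h₁, h₂, h₃, h₄⟩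
  choose! Q hQi hQt hQs hQ using key
  have hQA (a) (ha : a ∈ A) : (Q a).init ∈ Λ.A := hQi a ha ▸ (hF _ (hP a ha).1).1.1
  have hQf (a) (ha : a ∈ A) : f (Q a).init = a := hQi a ha ▸ (hP a ha).2
  have hd : ∀ a ∈ A, ∀ b ∈ A, a ≠ b → (Q a).support ∩ (Q b).support ⊆ {s} := by
    intro a ha b hb hab
    refine (inter_subset_inter (hQs a ha) (hQs b hb)).trans
      (hj _ (hP a ha).1 _ (hP b hb).1 fun h ↦ hab ?_)
    rw [← (hP a ha).2, h, (hP b hb).2]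
  have hsplit : A = {a ∈ A | (Q a).ter ≠ s} ∪ {a ∈ A | (Q a).ter = s} := by
    ext a
    simp only [mem_union, mem_ofPred_eq]
    tauto
  obtain h | h := (isStationary_union_iff hc.ne').1 (hsplit ▸ hst)
  · refine absurd (isStronglyPopular_of_indexing h
      (fun a ha ↦ ⟨hQA a ha.1, hQf a ha.1, hQt a ha.1, hQ a ha.1⟩) ?_) hns
    refine fun a ha b hb hab ↦ disjoint_left.2 fun v hva hvb ↦ ?_
    obtain rfl : v = s := hd a ha.1 b hb.1 hab.ne ⟨hva, hvb⟩
    exact ha.2 (hQ a ha.1 v hva hs).symm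
  · refine ⟨_, h, Q, fun a ha ↦ ⟨hQA a ha.1, hQf a ha.1, ha.2, ?_, ?_⟩,
      fun a ha b hb ↦ hd a ha.1 b hb.1⟩
    · exact ha.2 ▸ support_subset_RFo hS (hQA a ha.1) (hQ a ha.1)
    · exact fun v hv hvS ↦ (hQ a ha.1 v hv hvS).trans ha.2

/-! ### The cardinality bound. -/

theorem mk_diff_le_of_isPopularBehind (hc : ℵ₀ < Order.cof (Iio κ.ord))
    (hI : ∀ a : Iio κ.ord, #(Iio a) < Order.cof (Iio κ.ord))
    (hns : ¬ Λ.IsStronglyPopular f S) (hS : ∀ s ∈ S \ Λ.A, Λ.IsPopularBehind f S s) :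
    #(S \ Λ.A : Set V) ≤ κ := by
  obtain ⟨G, hG, hnone⟩ := exists_greedy_choice
    (fun (a : Iio κ.ord) (Q : DiPath Λ.D) ↦ Q.init ∈ Λ.A ∧ f Q.init = a ∧ Q.ter ∈ S ∧
      ∀ v ∈ Q.support, v ∈ S → v = Q.ter)
    (fun Q Q' ↦ Disjoint Q.support Q'.support)
  have hsub : ∀ s ∈ S \ Λ.A, ∃ a Q, G a = some Q ∧ Q.ter = s := by
    intro s hs
    by_contra! hunused
    obtain ⟨A, hA, P, hP, hd⟩ := hS s hs
    have hsplit : A ⊆ {a | ∃ Q, G a = some Q} ∪ {a ∈ A | G a = none} := fun a ha ↦ by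
      cases h : G a with
      | none => exact Or.inr ⟨ha, h⟩
      | some Q => exact Or.inl ⟨Q, h⟩
    -- Stationarily many greedy choices would make `S` strongly popular. Otherwise stationarily many
    -- `P a` are blocked by earlier choices.
    obtain h | h := (isStationary_union_iff hc.ne').1 (hA.mono hsplit)
    · have : Nonempty (DiPath Λ.D) := ⟨h.nonempty.some_mem.choose⟩
      choose! Q hQ using fun a (ha : a ∈ {a | ∃ Q, G a = some Q}) ↦ ha
      exact hns (isStronglyPopular_of_indexing h (fun a ha ↦ (hG a _ (hQ a ha)).1)
        fun a ha b hb hab ↦ (hG b _ (hQ b hb)).2 a hab _ (hQ a ha))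
    · have hmeet : ∀ a ∈ {a ∈ A | G a = none}, ∃ v ∈ (P a).support,
          ∃ b < a, v ∈ {v | ∃ Q, G b = some Q ∧ v ∈ Q.support} := by
        rintro a ⟨ha, hGa⟩
        obtain ⟨hi, hf, ht, -, hS'⟩ := hP a ha
        obtain ⟨b, hb, Q, hQ, hdis⟩ := hnone a hGa (P a)
          ⟨hi, hf, ht ▸ hs.1, fun v hv hvS ↦ (hS' v hv hvS).trans ht.symm⟩
        obtain ⟨v, hvQ, hvP⟩ := not_disjoint_iff.1 hdis
        exact ⟨v, hvP, b, hb, Q, hQ, hvQ⟩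
      have : Nonempty V := ⟨s⟩
      choose! v hvP hv using hmeet
      obtain ⟨x, hx⟩ := h.exists_const_of_mem_finite hc hI
        (W := fun b ↦ {v | ∃ Q, G b = some Q ∧ v ∈ Q.support}) (fun b ↦ by
          cases h : G b with
          | none => simp
          | some Q => simpa using Q.finite_support) hv
      obtain ⟨a, ha⟩ := hx.nonempty
      obtain ⟨b, hb, hab⟩ := hx.exists_gt_mem hc a
      -- Two of the paths `P a` share the blocking vertex, so it is `s`; a chosen path through `s`
      -- ends there.
      obtain rfl : x = s := hd a ha.1.1 b hb.1.1 hab.ne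
        ⟨ha.2 ▸ hvP a ha.1, hb.2 ▸ hvP b hb.1⟩
      obtain ⟨c, -, Q, hQ, hxQ⟩ := hv a ha.1
      rw [ha.2] at hxQ
      exact hunused c Q hQ ((hG c Q hQ).1.2.2.2 x hxQ hs.1).symm
  choose a Q hGQ hQt using hsub
  have hinj : Function.Injective fun s : (S \ Λ.A : Set V) ↦ a s.1 s.2 := fun s t h ↦ by
    have : Q s.1 s.2 = Q t.1 t.2 := Option.some.inj <| by
      rw [← hGQ, ← hGQ]
      exact congrArg G h
    exact Subtype.ext <| by rw [← hQt s.1 s.2, this, hQt]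
  have := Cardinal.lift_mk_le_lift_mk_of_injective hinj
  rw [Cardinal.mk_Iio_ordinal, card_ord, Cardinal.lift_lift] at this
  simpa using this

end Web

theorem theorem8 {V : Type u} {κ : Cardinal.{u}} (hκ : κ.IsRegular) (hκ' : ℵ₀ < κ)
    (Λ : Web V) (f g : V → Set.Iio κ.ord) (hfg : Λ.IsUnbalancedBy f g) :
    ∃ S : Set V,
      Λ.Separates S Λ.A Λ.B ∧
      (∀ s ∈ S, Λ.IsPopularWithin f (Λ.RFo S ∪ {s}) {s}) ∧
      ¬ Λ.IsStronglyPopular f S ∧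
      #(S \ Λ.A : Set V) ≤ κ := by
  have hc : ℵ₀ < Order.cof (Iio κ.ord) := by
    rwa [cof_Iio_ord_of_isRegular hκ, aleph0_lt_lift]
  have hI := mk_Iio_lt_cof_of_isRegular hκ
  have hsep : Λ.Separates (Λ.essential (Λ.popular f)) Λ.A Λ.B :=
    Web.separates_essential Web.A_subset_popular
  have hns := Web.not_isStronglyPopular_essential_popular hc hI hfg
  have hbehind : ∀ s ∈ Λ.essential (Λ.popular f) \ Λ.A,
      Λ.IsPopularBehind f (Λ.essential (Λ.popular f)) s := fun s hs ↦
    Web.isPopularBehind_of_mem_popular hc hsep hns hs.1 hs.1.1 hs.2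
  refine ⟨_, hsep, fun s hs ↦ ?_, hns, Web.mk_diff_le_of_isPopularBehind hc hI hns hbehind⟩
  by_cases hsA : s ∈ Λ.A
  · exact Or.inl ⟨s, rfl, hsA, Or.inr rfl⟩
  · exact (hbehind s ⟨hs, hsA⟩).isPopularWithin
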